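/- Let $\mathbb T^d=\mathbb R^d/\mathbb Z^d$ be the flat torus with its quotient (Euclidean) distance, and let $u:\mathbb T^d\to\mathbb R$ be semiconcave with linear modulus, i.e. $u$ is continuous and there is $C>0$ such that, identifying $u$ with a $\mathbb Z^d$-periodic function on $\mathbb R^d$, $$\lambda u(a)+(1-\lambda)u(b)-u(\lambda a+(1-\lambda)b)\le \tfrac C2\lambda(1-\lambda)|a-b|^2\qquad\text{for all } a,b\in\mathbb R^d,\ \lambda\in[0,1].$$ Let $$D^+u(y)=\Big\{p\in\mathbb R^d:\ \limsup_{v\to0}\frac{u(y+v)-u(y)-\langle p,v\rangle}{|v|}\le 0\Big\}$$ be the superdifferential of $u$ at $y\in\mathbb T^d$, and let $\operatorname{Crit}(u)=\{y\in\mathbb T^d:\ 0\in D^+u(y)\}$ be the critical set of $u$. Then, for every $x\in\mathbb T^d$, there is a unique curve $\mathbf x_u(\cdot,x):[0,\infty)\to\mathbb T^d$, Lipschitz on every bounded interval, such that $$\dot{\mathbf x}_u(t,x)\in D^+u(\mathbf x_u(t,x))\ \text{ for a.e. } t\ge0,\qquad \mathbf x_u(0,x)=x$$ (the generalised gradient flow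 of $u$), and for every $\varepsilon>0$ $$\lim_{T\to\infty}\frac1T\,\mathcal L^1\Big(\big\{t\in[0,T]:\ \operatorname{dist}\big(\mathbf x_u(t,x),\operatorname{Crit}(u)\big)\ge\varepsilon\big\}\Big)=0,$$ where $\mathcal L^1$ denotes Lebesgue measure on $\mathbb R$. -/

import Mathlib

open MeasureTheory Filter Topology

namespace TorusFlow

/-- The Euclidean space `ℝ^d`. -/
abbrev Euc (d : ℕ) : Type := EuclideanSpace ℝ (Fin d)

/-- The integer lattice `ℤ^d` in `ℝ^d`. -/
def intLattice (d : ℕ) : AddSubgroup (Euc d) where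
  carrier := {x | ∀ i, ∃ n : ℤ, x i = (n : ℝ)}
  zero_mem' := fun _ => ⟨0, by simp⟩
  add_mem' := by
    intro a b ha hb i
    obtain ⟨m, hm⟩ := ha i
    obtain ⟨n, hn⟩ := hb i
    exact ⟨m + n, by simp [hm, hn]⟩
  neg_mem' := by
    intro a ha i
    obtain ⟨m, hm⟩ := ha i
    exact ⟨-m, by simp [hm]⟩

/-- The flat torus `𝕋^d = ℝ^d / ℤ^d`. Its distance is the quotient distance
`dist (π a) (π b) = inf {|a - b - k| : k ∈ ℤ^d}`, with `|·|` the Euclidean norm. -/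
abbrev Torus (d : ℕ) : Type := Euc d ⧸ intLattice d

/-- The canonical projection `ℝ^d → 𝕋^d`. -/
def proj {d : ℕ} (a : Euc d) : Torus d := QuotientAddGroup.mk a

/-- Semiconcavity with linear modulus of a continuous function on the torus. The convex combinations
of two points of the torus are those of their representatives in `ℝ^d`. -/
def Semiconcave {d : ℕ} (u : Torus d → ℝ) : Prop :=
  Continuous u ∧ ∃ C : ℝ, 0 < C ∧ ∀ (a b : Euc d) (l : ℝ), 0 ≤ l → l ≤ 1 →
    l * u (proj a) + (1 - l) * u (proj b) - u (proj (l • a + (1 - l) • b))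
      ≤ C / 2 * (l * (1 - l)) * ‖a - b‖ ^ 2

/-- The superdifferential `D⁺u(x)`: the vectors `p` of `ℝ^d` such that
`limsup_{y → x} (u(y) - u(x) - ⟨p, y - x⟩) / |y - x| ≤ 0`, where `y = x + v` with `v → 0`, `v ≠ 0`
in `ℝ^d`. The upper limit is taken in the extended reals. -/
def superdiff {d : ℕ} (u : Torus d → ℝ) (x : Torus d) : Set (Euc d) :=
  {p | limsup (fun v : Euc d => (((u (x + proj v) - u x - inner ℝ p v) / ‖v‖ : ℝ) : EReal))
    (𝓝[≠] (0 : Euc d)) ≤ 0}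

/-- The critical set of `u`. -/
def crit {d : ℕ} (u : Torus d → ℝ) : Set (Torus d) := {x | (0 : Euc d) ∈ superdiff u x}

/-- The curve `γ : [0, ∞) → 𝕋^d` is a (locally Lipschitz) solution of
`γ'(t) ∈ D⁺u(γ(t))` for a.e. `t ≥ 0`, `γ(0) = x`. The velocity of a curve in the torus is the
derivative of a lift of the curve to `ℝ^d` (a locally Lipschitz curve in the torus has locally
Lipschitz lifts, and two lifts differ by a constant vector of `ℤ^d`).
The values of `γ` at negative times play no role. -/
def IsGradientCurve {d : ℕ} (u : Torus d → ℝ) (x : Torus d) (γ : ℝ → Torus d) : Prop :=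
  γ 0 = x ∧ ∃ g : ℝ → Euc d,
    (∀ t, 0 ≤ t → γ t = proj (g t)) ∧
    (∀ T : ℝ, ∃ K : NNReal, LipschitzOnWith K g (Set.Icc 0 T)) ∧
    ∀ᵐ t ∂(volume.restrict (Set.Ici (0 : ℝ))), ∃ v ∈ superdiff u (γ t), HasDerivAt g v t

end TorusFlow

/-!
The function `u` is lifted to the periodic, bounded function `U = u ∘ proj` on `ℝ^d`. For a
semiconcave function the superdifferential at `a` consists of the `p` with
`U b ≤ U a + ⟪p, b - a⟫ + C / 2 * ‖b - a‖ ^ 2` for all `b` (`mem_superdiff_proj_iff`). Hence its graph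
is closed, its elements are bounded, and it satisfies
`⟪p - q, a - b⟫ ≤ C * ‖a - b‖ ^ 2` for `p ∈ D⁺U(a)` and `q ∈ D⁺U(b)`. The last estimate and Gronwall's
argument give uniqueness (`eqOn_of_ae_isSupergradient`).

For existence, the implicit Euler scheme `X (k + 1) ∈ argmax (U - ‖· - X k‖ ^ 2 / (2 * h))` is used.
It satisfies a discrete evolution variational inequality, which compares `‖X m - y‖ ^ 2` and
`‖X j - y‖ ^ 2` for an arbitrary point `y` and involves no derivative. The inequality passes to any
pointwise limit as `h → 0` (`exists_isEVICurve`), and wherever the limit curve is differentiable,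
that is almost everywhere, it says that the velocity is a supergradient
(`IsEVICurve.isSupergradient_of_hasDerivAt`).

Along the flow `U` increases at the rate `‖g'‖ ^ 2`. As `U` is bounded, `‖g'‖ ^ 2` has a finite
integral over `[0, ∞)` (`IsEVICurve.measureReal_mul_le`). At distance at least `ε` from the critical
set the supergradients are bounded away from `0`, by compactness
(`exists_le_norm_sq_of_le_infEDist_crit`), so the flow spends only a finite total time there, and the
proportion of this time in `[0, T]` tends to `0`.
-/

namespace TorusFlow

/-! ### Supergradients of semiconcave functions -/

section

variable {E : Type*} [NormedAddCommGroup E] [InnerProductSpace ℝ E]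

/-- `p` is a supergradient of `U` at `a` with the quadratic error `C / 2 * ‖b - a‖ ^ 2`, globally.
For functions that are semiconcave with constant `C` this is equivalent to the local,
first-order definition of the superdifferential, and unlike the latter it is visibly closed in
`(a, p)`. -/
def IsSupergradient (C : ℝ) (U : E → ℝ) (a p : E) : Prop :=
  ∀ b, U b ≤ U a + inner ℝ p (b - a) + C / 2 * ‖b - a‖ ^ 2

/-- Semiconcavity with linear modulus and constant `C`, without the continuity requirement. -/
def IsSemiconcaveWith (C : ℝ) (U : E → ℝ) : Prop :=
  ∀ (a b : E) (l : ℝ), 0 ≤ l → l ≤ 1 →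
    l * U a + (1 - l) * U b - U (l • a + (1 - l) • b) ≤ C / 2 * (l * (1 - l)) * ‖a - b‖ ^ 2

/-- A first-order supergradient of a semiconcave function is a global supergradient: compare `b` with
the points `a + l • (b - a)` as `l → 0`. -/
theorem IsSemiconcaveWith.isSupergradient {C : ℝ} {U : E → ℝ} (hC : 0 ≤ C)
    (hU : IsSemiconcaveWith C U) {a p : E}
    (h : ∀ ε > 0, ∀ᶠ v in 𝓝[≠] (0 : E), U (a + v) - U a - inner ℝ p v ≤ ε * ‖v‖) :
    IsSupergradient C U a p := by
  intro b
  obtain ⟨v, rfl⟩ : ∃ v, b = a + v := ⟨b - a, by abel⟩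
  rw [add_sub_cancel_left]
  rcases eq_or_ne v 0 with rfl | hv
  · simp
  have hv' : 0 < ‖v‖ := norm_pos_iff.2 hv
  refine le_of_forall_pos_le_add fun ε hε => ?_
  have ht : Tendsto (fun l : ℝ => l • v) (𝓝[>] 0) (𝓝[≠] (0 : E)) := by
    refine tendsto_nhdsWithin_iff.2 ⟨?_, ?_⟩
    · have : Tendsto (fun l : ℝ => l • v) (𝓝 0) (𝓝 ((0 : ℝ) • v)) :=
        (continuous_id.smul continuous_const).tendsto 0
      rw [zero_smul] at this
      exact this.mono_left nhdsWithin_le_nhds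
    · filter_upwards [self_mem_nhdsWithin] with l hl
      exact smul_ne_zero (ne_of_gt hl) hv
  have h1 : ∀ᶠ l : ℝ in 𝓝[>] 0, l < 1 := nhdsWithin_le_nhds (Iio_mem_nhds one_pos)
  obtain ⟨l, hl, hl1, hl0⟩ := ((ht.eventually (h (ε / ‖v‖) (by positivity))).and
    (h1.and self_mem_nhdsWithin)).exists
  have hl0 : 0 < l := hl0
  have hs := hU (a + v) a l hl0.le hl1.le
  have e1 : l • (a + v) + (1 - l) • a = a + l • v := by
    rw [smul_add, sub_smul, one_smul]; abel
  have e2 : ε / ‖v‖ * ‖l • v‖ = l * ε := by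
    rw [norm_smul, Real.norm_of_nonneg hl0.le]; field_simp
  rw [e1, add_sub_cancel_left] at hs
  rw [e2, inner_smul_right] at hl
  have h3 : 0 ≤ C / 2 * (l * l) * ‖v‖ ^ 2 := by positivity
  refine le_of_mul_le_mul_left ?_ hl0
  linarith

namespace IsSupergradient

variable {C : ℝ} {U : E → ℝ} {a b p q : E}

/-- The superdifferential is monotone up to the linear term `C`. -/
theorem inner_sub_le (ha : IsSupergradient C U a p) (hb : IsSupergradient C U b q) :
    inner ℝ (p - q) (a - b) ≤ C * ‖a - b‖ ^ 2 := by
  have h1 := ha b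
  have h2 := hb a
  rw [← neg_sub a b, inner_neg_right, norm_neg] at h1
  rw [inner_sub_left]
  linarith

/-- Supergradients of a bounded function are bounded: move a unit distance against `p`. -/
theorem norm_le {M : ℝ} (ha : IsSupergradient C U a p) (hC : 0 ≤ C) (hM : ∀ y, |U y| ≤ M) :
    ‖p‖ ≤ 2 * M + C / 2 := by
  have hM0 : 0 ≤ M := (abs_nonneg _).trans (hM a)
  rcases eq_or_ne p 0 with rfl | hp
  · rw [norm_zero]; positivity
  have hp' : 0 < ‖p‖ := norm_pos_iff.2 hp
  have h := ha (a + -(‖p‖⁻¹ • p))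
  have e : ‖-(‖p‖⁻¹ • p)‖ = 1 := by
    rw [norm_neg, norm_smul, norm_inv, norm_norm, inv_mul_cancel₀ hp'.ne']
  rw [add_sub_cancel_left, e, inner_neg_right, inner_smul_right, real_inner_self_eq_norm_sq,
    pow_two, inv_mul_cancel_left₀ hp'.ne'] at h
  have h1 := abs_le.1 (hM a)
  have h2 := abs_le.1 (hM (a + -(‖p‖⁻¹ • p)))
  linarith [h1.2, h2.1]

end IsSupergradient

theorem isClosed_setOf_isSupergradient {C : ℝ} {U : E → ℝ} (hU : Continuous U) :
    IsClosed {z : E × E | IsSupergradient C U z.1 z.2} := by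
  simp only [IsSupergradient, Set.ofPred_forall]
  refine isClosed_iInter fun b => isClosed_le (by fun_prop) (by fun_prop)

/-- One step of the implicit Euler scheme: `z` maximizes `y ↦ U y - ‖y - x‖ ^ 2 / (2 * h)`.
The maximality makes `h⁻¹ • (z - x)` a supergradient at `z` up to a quadratic error of size `1 / h`,
which semiconcavity improves to `C / 2`. -/
theorem exists_implicit_step [ProperSpace E] {C M : ℝ} {U : E → ℝ} (hC : 0 ≤ C)
    (hU : IsSemiconcaveWith C U) (hUc : Continuous U) (hM : ∀ y, |U y| ≤ M) {h : ℝ} (hh : 0 < h)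
    (x : E) : ∃ z, IsSupergradient C U z (h⁻¹ • (z - x)) ∧ U x ≤ U z := by
  obtain ⟨z, hz⟩ : ∃ z, ∀ y, U y - (2 * h)⁻¹ * ‖y - x‖ ^ 2 ≤ U z - (2 * h)⁻¹ * ‖z - x‖ ^ 2 := by
    refine Continuous.exists_forall_ge (f := fun y => U y - (2 * h)⁻¹ * ‖y - x‖ ^ 2)
      (by fun_prop) ?_
    have h1 : Tendsto (fun y => ‖y - x‖) (cocompact E) atTop := by
      simpa only [dist_eq_norm] using tendsto_dist_right_cocompact_atTop x
    have h2 : Tendsto (fun y => (2 * h)⁻¹ * ‖y - x‖ ^ 2) (cocompact E) atTop :=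
      ((tendsto_pow_atTop two_ne_zero).comp h1).const_mul_atTop (by positivity)
    simp only [sub_eq_add_neg _ (_ * _)]
    exact tendsto_atBot_add_left_of_ge _ M (fun y => (abs_le.1 (hM y)).2)
      (tendsto_neg_atTop_atBot.comp h2)
  refine ⟨z, hU.isSupergradient hC fun ε hε => ?_, ?_⟩
  · have hev : ∀ᶠ v in 𝓝[≠] (0 : E), ‖v‖ < 2 * h * ε := by
      refine nhdsWithin_le_nhds ?_
      filter_upwards [Metric.ball_mem_nhds (0 : E) (show 0 < 2 * h * ε by positivity)] with v hv
      exact mem_ball_zero_iff.1 hv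
    filter_upwards [hev] with v hv
    have h1 := hz (z + v)
    have e : z + v - x = (z - x) + v := by abel
    rw [e, norm_add_sq_real] at h1
    rw [real_inner_smul_left]
    have h2 : (2 * h)⁻¹ * ‖v‖ ^ 2 ≤ ε * ‖v‖ := by
      rw [pow_two, ← mul_assoc]
      refine mul_le_mul_of_nonneg_right ?_ (norm_nonneg _)
      rw [inv_mul_le_iff₀ (by positivity)]
      exact hv.le
    have h3 : (2 * h)⁻¹ * (2 * inner ℝ (z - x) v) = h⁻¹ * inner ℝ (z - x) v := by
      field_simp
    linarith
  · have h1 := hz x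
    rw [sub_self, norm_zero] at h1
    have : 0 ≤ (2 * h)⁻¹ * ‖z - x‖ ^ 2 := by positivity
    linarith

/-! ### The implicit Euler scheme -/

/-- An implicit Euler scheme of step `h` for the inclusion `g' ∈ D⁺U(g)`, along which `U` does not
decrease. -/
structure IsImplicitScheme (C : ℝ) (U : E → ℝ) (h : ℝ) (X : ℕ → E) : Prop where
  isSupergradient : ∀ k, IsSupergradient C U (X (k + 1)) (h⁻¹ • (X (k + 1) - X k))
  monotone : Monotone (U ∘ X)

theorem exists_isImplicitScheme [ProperSpace E] {C M : ℝ} {U : E → ℝ} (hC : 0 ≤ C)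
    (hU : IsSemiconcaveWith C U) (hUc : Continuous U) (hM : ∀ y, |U y| ≤ M) {h : ℝ} (hh : 0 < h)
    (x : E) : ∃ X : ℕ → E, X 0 = x ∧ IsImplicitScheme C U h X := by
  choose F hF1 hF2 using exists_implicit_step hC hU hUc hM hh
  refine ⟨fun k => F^[k] x, rfl, fun k => ?_, monotone_nat_of_le_succ fun k => ?_⟩
  · simp only [Function.iterate_succ_apply']
    exact hF1 _
  · simp only [Function.comp, Function.iterate_succ_apply']
    exact hF2 _

namespace IsImplicitScheme

variable {C M h : ℝ} {U : E → ℝ} {X : ℕ → E}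

theorem norm_sub_le (hX : IsImplicitScheme C U h X) (hC : 0 ≤ C) (hM : ∀ y, |U y| ≤ M)
    (hh : 0 < h) {j m : ℕ} (hjm : j ≤ m) :
    ‖X m - X j‖ ≤ (2 * M + C / 2) * ((m - j : ℝ) * h) := by
  induction m, hjm using Nat.le_induction with
  | base => simp
  | succ m hm ih =>
    have h1 := (hX.isSupergradient m).norm_le hC hM
    rw [norm_smul, norm_inv, Real.norm_of_nonneg hh.le, inv_mul_le_iff₀ hh] at h1
    have h2 := norm_add_le (X (m + 1) - X m) (X m - X j)
    rw [sub_add_sub_cancel] at h2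
    push_cast
    linarith

/-- The discrete evolution variational inequality. Since `U` is nondecreasing along the scheme, its
values at the intermediate steps are bounded by the value at the last one; so no modulus of
continuity of `U` is needed. -/
theorem norm_sq_sub_norm_sq_le (hX : IsImplicitScheme C U h X) (hC : 0 ≤ C)
    (hM : ∀ y, |U y| ≤ M) (hh : 0 < h) {j m : ℕ} (hjm : j ≤ m) (y : E) :
    ‖X m - y‖ ^ 2 / 2 - ‖X j - y‖ ^ 2 / 2 ≤ (m - j : ℝ) * h *
      (U (X m) - U y + C / 2 * (‖X m - y‖ + (2 * M + C / 2) * ((m - j : ℝ) * h)) ^ 2) := by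
  have hM0 : 0 ≤ M := (abs_nonneg _).trans (hM y)
  set R := U (X m) - U y + C / 2 * (‖X m - y‖ + (2 * M + C / 2) * ((m - j : ℝ) * h)) ^ 2 with hR
  have key : ∀ i, j ≤ i → i ≤ m →
      ‖X i - y‖ ^ 2 / 2 - ‖X j - y‖ ^ 2 / 2 ≤ (i - j : ℝ) * h * R := by
    intro i hji
    induction i, hji using Nat.le_induction with
    | base => simp
    | succ i hi ih =>
      intro him
      have ih := ih (by omega)
      have h1 := hX.isSupergradient i y
      have h2 := hX.norm_sub_le hC hM hh him
      have h3 : U (X (i + 1)) ≤ U (X m) := hX.monotone him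
      have h4 : ‖X (i + 1) - y‖ ≤ ‖X m - y‖ + (2 * M + C / 2) * ((m - j : ℝ) * h) := by
        have h5 := _root_.norm_sub_le (X m - y) (X m - X (i + 1))
        rw [sub_sub_sub_cancel_left] at h5
        have h6 : (m - (i + 1 : ℕ) : ℝ) ≤ m - j := by
          have : (j : ℝ) ≤ (i + 1 : ℕ) := by exact_mod_cast (by omega)
          linarith
        have h7 : (2 * M + C / 2) * ((m - (i + 1 : ℕ) : ℝ) * h) ≤
          (2 * M + C / 2) * ((m - j : ℝ) * h) := by gcongr
        linarith
      have h5 : C / 2 * ‖X (i + 1) - y‖ ^ 2 ≤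
          C / 2 * (‖X m - y‖ + (2 * M + C / 2) * ((m - j : ℝ) * h)) ^ 2 := by gcongr
      rw [← neg_sub (X (i + 1)) y, inner_neg_right, norm_neg, real_inner_smul_left] at h1
      have h6 : h⁻¹ * inner ℝ (X (i + 1) - X i) (X (i + 1) - y) ≤ R := by linarith
      rw [inv_mul_le_iff₀ hh] at h6
      have h7 : X i - y = (X (i + 1) - y) - (X (i + 1) - X i) := by abel
      have h8 := norm_sub_sq_real (X (i + 1) - y) (X (i + 1) - X i)
      rw [← h7, real_inner_comm] at h8
      have h9 := sq_nonneg ‖X (i + 1) - X i‖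
      push_cast
      linarith
  exact key m hjm le_rfl

end IsImplicitScheme

end

/-! ### Curves satisfying an evolution variational inequality -/

section

variable {E : Type*} [NormedAddCommGroup E]

/-- Curves of speed at most `L` along which `U` is nondecreasing and which satisfy an evolution
variational inequality. All the conditions are closed under pointwise limits; at the points of
differentiability they give back the differential inclusion `g' ∈ D⁺U(g)`. -/
structure IsEVICurve (C L : ℝ) (U : E → ℝ) (g : ℝ → E) : Prop where
  norm_sub_le : ∀ s t, 0 ≤ s → s ≤ t → ‖g t - g s‖ ≤ L * (t - s)
  monotoneOn : MonotoneOn (U ∘ g) (Set.Ici 0)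
  evi : ∀ s t, 0 ≤ s → s ≤ t → ∀ y, ‖g t - y‖ ^ 2 / 2 - ‖g s - y‖ ^ 2 / 2 ≤
    (t - s) * (U (g t) - U y + C / 2 * (‖g t - y‖ + L * (t - s)) ^ 2)

theorem IsEVICurve.lipschitzOnWith {C L : ℝ} {U : E → ℝ} {g : ℝ → E} (hg : IsEVICurve C L U g) :
    LipschitzOnWith L.toNNReal g (Set.Ici 0) := by
  have key : ∀ s t, 0 ≤ s → s ≤ t → dist (g t) (g s) ≤ L.toNNReal * dist t s := by
    intro s t hs hst
    rw [dist_eq_norm, Real.dist_eq, abs_of_nonneg (sub_nonneg.2 hst)]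
    exact (hg.norm_sub_le s t hs hst).trans
      (mul_le_mul_of_nonneg_right (Real.le_coe_toNNReal L) (sub_nonneg.2 hst))
  refine LipschitzOnWith.of_dist_le_mul fun s hs t ht => ?_
  rcases le_total s t with h | h
  · rw [dist_comm, dist_comm s]
    exact key s t hs h
  · exact key t s ht h

end

section

variable {E : Type*} [NormedAddCommGroup E] [InnerProductSpace ℝ E]

/-- Implicit Euler schemes of step `1 / (n + 1)`, read at time `t` at the index `⌊t * (n + 1)⌋₊`,
stay in a compact ball depending on `t` only. Their pointwise limit along an ultrafilter on `ℕ` is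
an `IsEVICurve`, with no need to show that the schemes converge. -/
theorem exists_isEVICurve [ProperSpace E] {C M : ℝ} {U : E → ℝ} (hC : 0 ≤ C)
    (hU : IsSemiconcaveWith C U) (hUc : Continuous U) (hM : ∀ y, |U y| ≤ M) (x : E) :
    ∃ g : ℝ → E, g 0 = x ∧ IsEVICurve C (2 * M + C / 2) U g := by
  have hM0 : 0 ≤ M := (abs_nonneg _).trans (hM x)
  have hpos : ∀ n : ℕ, 0 < ((n : ℝ) + 1)⁻¹ := fun n => by positivity
  choose X hX0 hX using fun n : ℕ => exists_isImplicitScheme hC hU hUc hM (hpos n) x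
  let k : ℝ → ℕ → ℕ := fun t n => ⌊t * ((n : ℝ) + 1)⌋₊
  let ω : Ultrafilter ℕ := Ultrafilter.of atTop
  have hω : (ω : Filter ℕ) ≤ atTop := Ultrafilter.of_le atTop
  have hkmono : ∀ {s t : ℝ}, s ≤ t → ∀ n, k s n ≤ k t n := fun hst n =>
    Nat.floor_mono (mul_le_mul_of_nonneg_right hst (by positivity))
  have hk : ∀ t, 0 ≤ t → Tendsto (fun n : ℕ => (k t n : ℝ) * ((n : ℝ) + 1)⁻¹) ω (𝓝 t) := by
    intro t ht
    have h1 : Tendsto (fun n : ℕ => (n : ℝ) + 1) atTop atTop :=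
      tendsto_atTop_add_const_right _ _ tendsto_natCast_atTop_atTop
    exact ((tendsto_nat_floor_mul_div_atTop ht).comp h1).mono_left hω
  have hlim : ∀ t, ∃ y, Tendsto (fun n => X n (k t n)) ω (𝓝 y) := by
    intro t
    have hmem : ∀ n, X n (k t n) ∈ Metric.closedBall x ((2 * M + C / 2) * |t|) := by
      intro n
      rw [mem_closedBall_iff_norm, ← hX0 n]
      refine ((hX n).norm_sub_le hC hM (hpos n) (Nat.zero_le _)).trans ?_
      gcongr
      rw [Nat.cast_zero, sub_zero, mul_inv_le_iff₀ (by positivity)]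
      exact (Nat.floor_le_floor (mul_le_mul_of_nonneg_right (le_abs_self t) (by positivity))
        |> Nat.cast_le.2).trans (Nat.floor_le (by positivity))
    obtain ⟨y, -, hy⟩ := (isCompact_closedBall x ((2 * M + C / 2) * |t|)).ultrafilter_le_nhds'
      (ω.map fun n => X n (k t n)) (Filter.mem_map.2 (Eventually.of_forall hmem))
    exact ⟨y, hy⟩
  choose g hg using hlim
  have hdiff : ∀ {s t : ℝ}, 0 ≤ s → s ≤ t →
      Tendsto (fun n : ℕ => ((k t n : ℝ) - k s n) * ((n : ℝ) + 1)⁻¹) ω (𝓝 (t - s)) := by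
    intro s t hs hst
    simp only [sub_mul]
    exact (hk t (hs.trans hst)).sub (hk s hs)
  have hUg : ∀ t, Tendsto (fun n => U (X n (k t n))) ω (𝓝 (U (g t))) := fun t =>
    (hUc.tendsto _).comp (hg t)
  refine ⟨g, ?_, ⟨?_, ?_, ?_⟩⟩
  · refine tendsto_nhds_unique (hg 0) ?_
    simp [k, hX0]
  · intro s t hs hst
    refine le_of_tendsto_of_tendsto ((hg t).sub (hg s)).norm
      ((hdiff hs hst).const_mul (2 * M + C / 2)) (Eventually.of_forall fun n => ?_)
    exact (hX n).norm_sub_le hC hM (hpos n) (hkmono hst n)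
  · intro s _ t _ hst
    exact le_of_tendsto_of_tendsto (hUg s) (hUg t)
      (Eventually.of_forall fun n => (hX n).monotone (hkmono hst n))
  · intro s t hs hst y
    have hd := hdiff hs hst
    have ht := ((hg t).sub_const y).norm
    refine le_of_tendsto_of_tendsto
      (((ht.pow 2).div_const 2).sub ((((hg s).sub_const y).norm.pow 2).div_const 2))
      (hd.mul (((hUg t).sub_const (U y)).add
        (((ht.add (hd.const_mul (2 * M + C / 2))).pow 2).const_mul (C / 2))))
      (Eventually.of_forall fun n => ?_)
    exact (hX n).norm_sq_sub_norm_sq_le hC hM (hpos n) (hkmono hst n) y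

namespace IsEVICurve

variable {C L : ℝ} {U : E → ℝ} {g : ℝ → E}

/-- Divide the evolution variational inequality by `t - s` and let `s` increase to `t`. -/
theorem isSupergradient_of_hasDerivAt (hg : IsEVICurve C L U g) {t : ℝ} (ht : 0 < t) {v : E}
    (hv : HasDerivAt g v t) : IsSupergradient C U (g t) v := by
  intro y
  have hφ : HasDerivAt (fun s => ‖g s - y‖ ^ 2) (2 * inner ℝ (g t - y) v) t :=
    (hv.sub_const y).norm_sq
  have hslope := hφ.tendsto_slope.mono_left
    (nhdsWithin_mono t (fun s (hs : s < t) => hs.ne) : 𝓝[<] t ≤ 𝓝[≠] t)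
  have hR : Tendsto (fun s => 2 * (U (g t) - U y + C / 2 * (‖g t - y‖ + L * (t - s)) ^ 2))
      (𝓝[<] t) (𝓝 (2 * (U (g t) - U y + C / 2 * (‖g t - y‖ + L * (t - t)) ^ 2))) :=
    (Continuous.tendsto (by fun_prop) t).mono_left nhdsWithin_le_nhds
  have hle : ∀ᶠ s in 𝓝[<] t, slope (fun s => ‖g s - y‖ ^ 2) t s ≤
      2 * (U (g t) - U y + C / 2 * (‖g t - y‖ + L * (t - s)) ^ 2) := by
    filter_upwards [self_mem_nhdsWithin, nhdsWithin_le_nhds (Ioi_mem_nhds ht)] with s hs hs0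
    have hs : s < t := hs
    have h := hg.evi s t (le_of_lt hs0) hs.le y
    rw [slope_comm, slope_def_field, div_le_iff₀ (sub_pos.2 hs)]
    linarith
  have h := le_of_tendsto_of_tendsto hslope hR hle
  rw [sub_self, mul_zero, add_zero, real_inner_comm] at h
  rw [← neg_sub (g t) y, inner_neg_right, norm_neg]
  linarith

end IsEVICurve

theorem ae_hasDerivAt_of_lipschitzOnWith [FiniteDimensional ℝ E] {K : NNReal} {g : ℝ → E}
    (hg : LipschitzOnWith K g (Set.Ici 0)) :
    ∀ᵐ t ∂(volume.restrict (Set.Ici (0 : ℝ))), 0 < t ∧ ∃ v, HasDerivAt g v t := by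
  have h0 : ∀ᵐ t ∂(volume.restrict (Set.Ici (0 : ℝ))), t ≠ 0 :=
    ae_restrict_of_ae (by simp [ae_iff, measure_singleton])
  filter_upwards [hg.ae_differentiableWithinAt measurableSet_Ici (μ := volume), h0,
    ae_restrict_mem measurableSet_Ici] with t ht ht0 htm
  have hpos : 0 < t := lt_of_le_of_ne htm ht0.symm
  exact ⟨hpos, _, (ht.differentiableAt (Ici_mem_nhds hpos)).hasDerivAt⟩

/-! ### Uniqueness -/

/-- A gradient curve is determined by its initial point: the one-sided estimate
`IsSupergradient.inner_sub_le` makes `‖g₁ t - g₂ t‖ ^ 2 * exp (-2 * C * t)`, which is absolutely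
continuous, nonincreasing. -/
theorem eqOn_of_ae_isSupergradient {C : ℝ} {U : E → ℝ} {g₁ g₂ : ℝ → E}
    (h₁ : ∀ T : ℝ, ∃ K : NNReal, LipschitzOnWith K g₁ (Set.Icc 0 T))
    (h₂ : ∀ T : ℝ, ∃ K : NNReal, LipschitzOnWith K g₂ (Set.Icc 0 T))
    (hd₁ : ∀ᵐ t ∂(volume.restrict (Set.Ici (0 : ℝ))),
      ∃ v, IsSupergradient C U (g₁ t) v ∧ HasDerivAt g₁ v t)
    (hd₂ : ∀ᵐ t ∂(volume.restrict (Set.Ici (0 : ℝ))),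
      ∃ v, IsSupergradient C U (g₂ t) v ∧ HasDerivAt g₂ v t)
    (h0 : g₁ 0 = g₂ 0) : Set.EqOn g₁ g₂ (Set.Ici 0) := by
  intro T hT
  have hT : 0 ≤ T := hT
  obtain ⟨K₁, hK₁⟩ := h₁ T
  obtain ⟨K₂, hK₂⟩ := h₂ T
  let D : ℝ → ℝ := fun t => ‖g₁ t - g₂ t‖
  let e : ℝ → ℝ := fun t => Real.exp (-(2 * C) * t)
  let f : ℝ → ℝ := fun t => D t * D t * e t
  have hD : AbsolutelyContinuousOnInterval D 0 T := by
    have : LipschitzOnWith (1 * (K₁ + K₂)) (norm ∘ fun t => g₁ t - g₂ t) (Set.Icc 0 T) :=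
      lipschitzWith_one_norm.comp_lipschitzOnWith (hK₁.sub hK₂)
    rw [← Set.uIcc_of_le hT] at this
    exact this.absolutelyContinuousOnInterval
  have he : AbsolutelyContinuousOnInterval e 0 T := by
    refine ContDiffOn.absolutelyContinuousOnInterval (ContDiff.contDiffOn ?_)
    fun_prop
  have hf : AbsolutelyContinuousOnInterval f 0 T := (hD.mul hD).mul he
  have hneg : ∀ᵐ t ∂(volume.restrict (Set.Ioc 0 T)), deriv f t ≤ 0 := by
    have hsub : Set.Ioc 0 T ⊆ Set.Ici (0 : ℝ) := fun t ht => ht.1.le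
    filter_upwards [ae_restrict_of_ae_restrict_of_subset hsub hd₁,
      ae_restrict_of_ae_restrict_of_subset hsub hd₂] with t ⟨v, hv, hv'⟩ ⟨w, hw, hw'⟩
    have hDD : HasDerivAt (fun t => D t * D t) (2 * inner ℝ (g₁ t - g₂ t) (v - w)) t := by
      simpa only [D, pow_two, Pi.sub_apply] using (hv'.sub hw').norm_sq
    have hee : HasDerivAt e (e t * (-(2 * C))) t := by
      simpa only [id, mul_one] using ((hasDerivAt_id t).const_mul (-(2 * C))).exp
    have hff : HasDerivAt f _ t := hDD.mul hee
    rw [hff.deriv]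
    have h := hv.inner_sub_le hw
    rw [real_inner_comm] at h
    have he0 : 0 < e t := Real.exp_pos _
    have h' : D t * D t = ‖g₁ t - g₂ t‖ ^ 2 := (pow_two _).symm
    rw [h']
    nlinarith [mul_le_mul_of_nonneg_right h he0.le]
  have hint := hf.integral_deriv_eq_sub
  rw [intervalIntegral.integral_of_le hT] at hint
  have hle := integral_nonpos_of_ae hneg
  have hf0 : f 0 = 0 := by simp [f, D, h0]
  have hfT : D T * D T * e T ≤ 0 := by
    change f T ≤ 0
    linarith
  have hDT : D T * D T ≤ 0 := by
    by_contra! hlt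
    exact absurd hfT (not_le.2 (mul_pos hlt (Real.exp_pos _)))
  have hD0 : D T = 0 := mul_self_eq_zero.1 (le_antisymm hDT (mul_self_nonneg _))
  exact sub_eq_zero.1 (norm_eq_zero.1 hD0)

/-! ### The energy estimate -/

/-- The chain rule along a gradient curve: the quadratic upper bound of `U` touches `U` at `g t`, so
its difference with `U`, along `g`, has a minimum at time `t`. -/
theorem IsSupergradient.deriv_comp_eq {C : ℝ} {U : E → ℝ} {g : ℝ → E} {t : ℝ} {v : E}
    (h : IsSupergradient C U (g t) v) (hv : HasDerivAt g v t)
    (hd : DifferentiableAt ℝ (U ∘ g) t) : deriv (U ∘ g) t = ‖v‖ ^ 2 := by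
  let ψ : ℝ → ℝ := fun s =>
    U (g t) + inner ℝ v (g s - g t) + C / 2 * ‖g s - g t‖ ^ 2 - (U ∘ g) s
  have hmin : IsLocalMin ψ t := by
    refine Eventually.of_forall fun s => ?_
    have h1 := h (g s)
    simp only [ψ, sub_self, inner_zero_right, norm_zero, Function.comp_apply]
    linarith
  have hψ : HasDerivAt ψ (inner ℝ v v + C / 2 * (2 * inner ℝ (g t - g t) v) -
      deriv (U ∘ g) t) t := by
    have h1 : HasDerivAt (fun s => inner ℝ v (g s - g t)) (inner ℝ v v) t := by
      simpa using (hasDerivAt_const t v).inner ℝ (hv.sub_const (g t))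
    exact ((h1.const_add _).add ((hv.sub_const (g t)).norm_sq.const_mul (C / 2))).sub
      hd.hasDerivAt
  have h0 := hmin.hasDerivAt_eq_zero hψ
  rw [sub_self, inner_zero_left, real_inner_self_eq_norm_sq] at h0
  linarith

/-- The total increase of a bounded `U` along `g` is at most `2 * M`, and it dominates the integral of
`‖g'‖ ^ 2`. So `g` spends a time at most `2 * M / δ` in the places where all supergradients satisfy
`δ ≤ ‖v‖ ^ 2`. -/
theorem IsEVICurve.measureReal_mul_le [FiniteDimensional ℝ E] {C L M : ℝ} {U : E → ℝ}
    {g : ℝ → E} (hg : IsEVICurve C L U g) (hM : ∀ y, |U y| ≤ M) {δ : ℝ} (hδ : 0 ≤ δ) {B : Set ℝ}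
    (hB : ∀ t ∈ B, ∀ v, IsSupergradient C U (g t) v → δ ≤ ‖v‖ ^ 2) {T : ℝ} (hT : 0 ≤ T) :
    δ * volume.real (Set.Icc 0 T ∩ B) ≤ 2 * M := by
  let F : ℝ → ℝ := U ∘ g
  have hsub : Set.Ioc 0 T ⊆ Set.Ici (0 : ℝ) := fun t ht => ht.1.le
  have hmono : MonotoneOn F (Set.uIcc 0 T) := by
    rw [Set.uIcc_of_le hT]
    exact hg.monotoneOn.mono fun t ht => ht.1
  have hint : Integrable (deriv F) (volume.restrict (Set.Ioc 0 T)) :=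
    (intervalIntegrable_iff_integrableOn_Ioc_of_le hT).1 hmono.intervalIntegrable_deriv
  have hle : ∫ t in Set.Ioc 0 T, deriv F t ≤ 2 * M := by
    rw [← intervalIntegral.integral_of_le hT]
    have h1 := hmono.intervalIntegral_deriv_mem_uIcc
    have h0 : F 0 ≤ F T := hmono Set.left_mem_uIcc Set.right_mem_uIcc hT
    rw [Set.uIcc_of_le (sub_nonneg.2 h0)] at h1
    have h2 := (abs_le.1 (hM (g T))).2
    have h3 := (abs_le.1 (hM (g 0))).1
    have h4 : F T - F 0 = U (g T) - U (g 0) := rfl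
    linarith [h1.2]
  have hae : ∀ᵐ t ∂(volume.restrict (Set.Ioc 0 T)),
      ∃ v, IsSupergradient C U (g t) v ∧ deriv F t = ‖v‖ ^ 2 := by
    have hdF : ∀ᵐ t ∂(volume.restrict (Set.Ioc 0 T)),
        t ∈ Set.Ici (0 : ℝ) → DifferentiableWithinAt ℝ F (Set.Ici 0) t :=
      ae_restrict_of_ae hg.monotoneOn.ae_differentiableWithinAt_of_mem
    filter_upwards [hdF, ae_restrict_of_ae_restrict_of_subset hsub
      (ae_hasDerivAt_of_lipschitzOnWith hg.lipschitzOnWith)] with t htF ⟨ht0, v, hv⟩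
    have hs := hg.isSupergradient_of_hasDerivAt ht0 hv
    exact ⟨v, hs, hs.deriv_comp_eq hv ((htF ht0.le).differentiableAt (Ici_mem_nhds ht0))⟩
  have hnn : 0 ≤ᵐ[volume.restrict (Set.Ioc 0 T)] deriv F := by
    filter_upwards [hae] with t ⟨v, _, hv⟩
    rw [hv]
    exact sq_nonneg _
  have hmarkov := mul_meas_ge_le_integral_of_nonneg hnn hint δ
  refine (mul_le_mul_of_nonneg_left ?_ hδ).trans (hmarkov.trans hle)
  have hBle : B ≤ᵐ[volume.restrict (Set.Ioc 0 T)] {t | δ ≤ deriv F t} := by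
    filter_upwards [hae] with t ⟨v, hv, hv'⟩ htB
    exact (hB t htB v hv).trans_eq hv'.symm
  refine ENNReal.toReal_mono (measure_ne_top _ _) ?_
  calc volume (Set.Icc 0 T ∩ B) ≤ volume.restrict (Set.Icc 0 T) B := by
        rw [Set.inter_comm]
        exact Measure.le_restrict_apply _ _
    _ = volume.restrict (Set.Ioc 0 T) B := by rw [Measure.restrict_congr_set Ioc_ae_eq_Icc]
    _ ≤ _ := measure_mono_ae hBle

end

/-! ### Functions on the torus -/

variable {d : ℕ} {u : Torus d → ℝ} {C : ℝ}

theorem continuous_proj : Continuous (proj : Euc d → Torus d) := QuotientAddGroup.continuous_mk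

theorem proj_eq_proj {a b : Euc d} : proj a = proj b ↔ b - a ∈ intLattice d := by
  rw [proj, proj, QuotientAddGroup.eq, neg_add_eq_sub]

/-- The unit cube is a compact set of representatives. -/
theorem exists_isCompact_proj_surjOn (d : ℕ) :
    ∃ K : Set (Euc d), IsCompact K ∧ ∀ x : Torus d, ∃ a ∈ K, proj a = x := by
  refine ⟨WithLp.toLp 2 '' Set.univ.pi fun _ : Fin d => Set.Icc (0 : ℝ) 1,
    (isCompact_univ_pi fun _ => isCompact_Icc).image (PiLp.continuous_toLp 2 _), fun x => ?_⟩
  obtain ⟨a, rfl⟩ := QuotientAddGroup.mk_surjective x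
  refine ⟨_, ⟨fun i => Int.fract (a i), fun i _ => ⟨Int.fract_nonneg _, (Int.fract_lt_one _).le⟩,
    rfl⟩, proj_eq_proj.2 fun i => ⟨⌊a i⌋, ?_⟩⟩
  simp

theorem exists_abs_le (hu : Continuous u) : ∃ M, ∀ a : Euc d, |u (proj a)| ≤ M := by
  obtain ⟨K, hK, hKs⟩ := exists_isCompact_proj_surjOn d
  obtain ⟨M, hM⟩ := hK.exists_bound_of_continuousOn (hu.comp continuous_proj).continuousOn
  refine ⟨M, fun a => ?_⟩
  obtain ⟨b, hb, hab⟩ := hKs (proj a)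
  rw [← hab]
  exact hM b hb

/-- For a semiconcave function, the first-order superdifferential on the torus consists of the global
supergradients of the lift. In dimension `0`, where `𝓝[≠] 0 = ⊥`, both sides hold. -/
theorem mem_superdiff_proj_iff (hC : 0 ≤ C) (hu : IsSemiconcaveWith C fun a => u (proj a))
    {a p : Euc d} : p ∈ superdiff u (proj a) ↔ IsSupergradient C (fun a => u (proj a)) a p := by
  constructor
  · intro h
    refine hu.isSupergradient hC fun ε hε => ?_
    have h1 : limsup (fun v : Euc d =>
        (((u (proj a + proj v) - u (proj a) - inner ℝ p v) / ‖v‖ : ℝ) : EReal))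
        (𝓝[≠] (0 : Euc d)) < (ε : EReal) := lt_of_le_of_lt h (by exact_mod_cast hε)
    filter_upwards [eventually_lt_of_limsup_lt h1, self_mem_nhdsWithin] with v hv hv0
    have hv' : 0 < ‖v‖ := norm_pos_iff.2 hv0
    exact ((div_lt_iff₀ hv').1 (EReal.coe_lt_coe_iff.1 hv)).le
  · intro h
    have key : ∀ ε : ℝ, 0 < ε → limsup (fun v : Euc d =>
        (((u (proj a + proj v) - u (proj a) - inner ℝ p v) / ‖v‖ : ℝ) : EReal))
        (𝓝[≠] (0 : Euc d)) ≤ (ε : EReal) := by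
      intro ε hε
      have ht : Tendsto (fun v : Euc d => C / 2 * ‖v‖) (𝓝[≠] 0) (𝓝 (C / 2 * ‖(0 : Euc d)‖)) :=
        (Continuous.tendsto (by fun_prop) 0).mono_left nhdsWithin_le_nhds
      rw [norm_zero, mul_zero] at ht
      refine limsup_le_of_le (by isBoundedDefault) ?_
      filter_upwards [ht.eventually (gt_mem_nhds hε), self_mem_nhdsWithin] with v hv hv0
      have hv' : 0 < ‖v‖ := norm_pos_iff.2 hv0
      have h1 : u (proj a + proj v) ≤ _ := h (a + v)
      rw [add_sub_cancel_left] at h1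
      rw [EReal.coe_le_coe_iff, div_le_iff₀ hv']
      nlinarith [mul_le_mul_of_nonneg_right hv.le hv'.le]
    exact EReal.le_of_forall_lt_iff_le.1 fun ε hε => key ε (by exact_mod_cast hε)

/-- Away from the critical set the superdifferential stays away from `0`, by compactness of the torus
and closedness of the graph of the superdifferential. -/
theorem exists_le_norm_sq_of_le_infEDist_crit (hC : 0 ≤ C) (huc : Continuous u)
    (hu : IsSemiconcaveWith C fun a => u (proj a)) {ε : ℝ} (hε : 0 < ε) :
    ∃ δ > 0, ∀ x p, ENNReal.ofReal ε ≤ Metric.infEDist x (crit u) → p ∈ superdiff u x →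
      δ ≤ ‖p‖ ^ 2 := by
  obtain ⟨K, hK, hKs⟩ := exists_isCompact_proj_surjOn d
  let P : Set (Euc d × Euc d) := (K ×ˢ Metric.closedBall 0 1) ∩
    ({z | ENNReal.ofReal ε ≤ Metric.infEDist (proj z.1) (crit u)} ∩
      {z | IsSupergradient C (fun a => u (proj a)) z.1 z.2})
  have hP : IsCompact P := by
    refine (hK.prod (isCompact_closedBall _ _)).inter_right (IsClosed.inter ?_ ?_)
    · exact isClosed_le continuous_const
        (Metric.continuous_infEDist.comp (continuous_proj.comp continuous_fst))
    · exact isClosed_setOf_isSupergradient (huc.comp continuous_proj)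
  obtain ⟨δ, hδ, hδP⟩ : ∃ δ > 0, ∀ z ∈ P, δ ≤ ‖z.2‖ ^ 2 := by
    refine hP.exists_forall_le' (f := fun z => ‖z.2‖ ^ 2) (by fun_prop) (a := 0) fun z hz => ?_
    have hz0 : z.2 ≠ 0 := by
      intro h0
      have hcrit : proj z.1 ∈ crit u := by
        change (0 : Euc d) ∈ superdiff u (proj z.1)
        rw [mem_superdiff_proj_iff hC hu, ← h0]
        exact hz.2.2
      have h1 : ENNReal.ofReal ε ≤ Metric.infEDist (proj z.1) (crit u) := hz.2.1
      rw [Metric.infEDist_zero_of_mem hcrit] at h1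
      exact absurd h1 (not_le.2 (ENNReal.ofReal_pos.2 hε))
    have := norm_pos_iff.2 hz0
    positivity
  -- The compact set `P` only sees supergradients of norm at most `1`.
  refine ⟨min δ 1, lt_min hδ one_pos, fun x p hx hp => ?_⟩
  obtain ⟨a, haK, rfl⟩ := hKs x
  rcases le_or_gt ‖p‖ 1 with h | h
  · exact (min_le_left _ _).trans (hδP (a, p) ⟨⟨haK, by simpa using h⟩, hx,
      (mem_superdiff_proj_iff hC hu).1 hp⟩)
  · exact (min_le_right _ _).trans (one_le_pow₀ h.le)

theorem isGradientCurve_proj (hC : 0 ≤ C) (hu : IsSemiconcaveWith C fun a => u (proj a))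
    {L : ℝ} {g : ℝ → Euc d} (hg : IsEVICurve C L (fun a => u (proj a)) g) :
    IsGradientCurve u (proj (g 0)) fun t => proj (g t) := by
  refine ⟨rfl, g, fun _ _ => rfl,
    fun T => ⟨_, hg.lipschitzOnWith.mono Set.Icc_subset_Ici_self⟩, ?_⟩
  filter_upwards [ae_hasDerivAt_of_lipschitzOnWith hg.lipschitzOnWith] with t ⟨ht, v, hv⟩
  exact ⟨v, (mem_superdiff_proj_iff hC hu).2 (hg.isSupergradient_of_hasDerivAt ht hv), hv⟩

theorem IsGradientCurve.eqOn (hC : 0 ≤ C) (hu : IsSemiconcaveWith C fun a => u (proj a))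
    {x : Torus d} {γ η : ℝ → Torus d} (hγ : IsGradientCurve u x γ) (hη : IsGradientCurve u x η) :
    Set.EqOn η γ (Set.Ici 0) := by
  obtain ⟨hγ0, g, hg, hgL, hgd⟩ := hγ
  obtain ⟨hη0, f, hf, hfL, hfd⟩ := hη
  -- The two lifts start at points that differ by a lattice vector; translate one of them by it.
  have hk : g 0 - f 0 ∈ intLattice d := by
    rw [← proj_eq_proj, ← hf 0 le_rfl, ← hg 0 le_rfl, hη0, hγ0]
  have hp : ∀ a, proj (a + (g 0 - f 0)) = proj a := fun a =>
    (proj_eq_proj.2 (by rwa [add_sub_cancel_left])).symm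
  have hfg : Set.EqOn (fun t => f t + (g 0 - f 0)) g (Set.Ici 0) := by
    refine eqOn_of_ae_isSupergradient (C := C) (U := fun a => u (proj a)) (fun T => ?_) hgL ?_ ?_
      (by simp)
    · obtain ⟨K, hK⟩ := hfL T
      exact ⟨K, fun s hs t ht => by simpa using hK hs ht⟩
    · filter_upwards [hfd, ae_restrict_mem measurableSet_Ici] with t ⟨v, hv, hv'⟩ ht
      refine ⟨v, (mem_superdiff_proj_iff hC hu).1 ?_, hv'.add_const _⟩
      rwa [hp, ← hf t ht]
    · filter_upwards [hgd, ae_restrict_mem measurableSet_Ici] with t ⟨v, hv, hv'⟩ ht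
      refine ⟨v, (mem_superdiff_proj_iff hC hu).1 ?_, hv'⟩
      rwa [← hg t ht]
  intro t ht
  rw [hf t ht, hg t ht, ← hp (f t)]
  exact congrArg proj (hfg ht)

end TorusFlow

theorem mainTheorem1 (d : ℕ) (u : TorusFlow.Torus d → ℝ) (hu : TorusFlow.Semiconcave u)
    (x : TorusFlow.Torus d) :
    ∃ γ : ℝ → TorusFlow.Torus d,
      TorusFlow.IsGradientCurve u x γ ∧
      (∀ η : ℝ → TorusFlow.Torus d, TorusFlow.IsGradientCurve u x η →
        Set.EqOn η γ (Set.Ici 0)) ∧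
      ∀ ε : ℝ, 0 < ε →
        Tendsto
          (fun T : ℝ => 1 / T * (volume {t : ℝ | t ∈ Set.Icc 0 T ∧
            ENNReal.ofReal ε ≤ Metric.infEDist (γ t) (TorusFlow.crit u)}).toReal)
          atTop (𝓝 0) := by
  obtain ⟨huc, C, hC, hsc⟩ := hu
  have hU : TorusFlow.IsSemiconcaveWith C fun a => u (TorusFlow.proj a) := hsc
  obtain ⟨M, hM⟩ := TorusFlow.exists_abs_le huc
  obtain ⟨a, rfl⟩ := QuotientAddGroup.mk_surjective x
  obtain ⟨g, rfl, hg⟩ := TorusFlow.exists_isEVICurve hC.le hU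
    (huc.comp TorusFlow.continuous_proj) hM a
  have hγ := TorusFlow.isGradientCurve_proj hC.le hU hg
  refine ⟨_, hγ, fun η hη => hγ.eqOn hC.le hU hη, fun ε hε => ?_⟩
  obtain ⟨δ, hδ, hδp⟩ :=
    TorusFlow.exists_le_norm_sq_of_le_infEDist_crit hC.le huc hU hε
  have hlim : Tendsto (fun T : ℝ => 1 / T * (2 * M / δ)) atTop (𝓝 0) := by
    simpa using tendsto_inv_atTop_zero.mul_const (2 * M / δ)
  refine squeeze_zero' ?_ ?_ hlim
  · filter_upwards [eventually_ge_atTop 0] with T hT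
    positivity
  · filter_upwards [eventually_ge_atTop 0] with T hT
    refine mul_le_mul_of_nonneg_left ?_ (by positivity)
    rw [le_div_iff₀' hδ]
    exact hg.measureReal_mul_le hM hδ.le (fun t ht v hv => hδp _ v ht
      ((TorusFlow.mem_superdiff_proj_iff hC.le hU).2 hv)) hT
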